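/- Let $a:\mathbb{Z}\to(-\infty,0)$ and $b:\mathbb{Z}\to\mathbb{R}$ be bounded sequences with $\lim_{|n|\to\infty}a(n)=-1$, and let $W$ be the scalar Jacobi operator on $\ell^2(\mathbb{Z})$, $$(Wu)(n)=a(n-1)u(n-1)+a(n)u(n+1)+b(n)u(n),\qquad n\in\mathbb{Z}.$$ Let $\lambda_1,\lambda_2,\dots$ (none, finitely many or infinitely many) denote the distinct eigenvalues of the self-adjoint operator $W$ outside $[-2,2]$, that is, with $|\lambda_j|>2$. Then for every $\gamma>\frac12$ $$\sum_{j}\int_2^{|\lambda_j|}(E^2-4)^{\frac12}(|\lambda_j|-E)^{\gamma-\frac32}\,\mathrm{d}E\;\le\;3^{\gamma-\frac12}\,\mathrm{B}\!\left(\gamma-\tfrac12,2\right)\left(\sum_{n\in\mathbb{Z}}|b(n)|^{\gamma+\frac12}+4\sum_{n\in\mathbb{Z}}|a(n)+1|^{\gamma+\frac12}\right),$$ where $\mathrm{B}(x,y)=\frac{\Gamma(x)\Gamma(y)}{\Gamma(x+y)}$. Both sides are read in $[0,\infty]$; in particular, if the right-hand side is finite, then so is the left-hand side. -/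

import Mathlib

open Filter Topology
open scoped ENNReal lp

/-- The complex Hilbert space of square-summable two-sided sequences. -/
abbrev EllTwo : Type := lp (fun _ : ℤ => ℂ) 2

theorem memlp_two_comp {f : ℤ → ℂ} (hf : Memℓp f 2) (e : ℤ ≃ ℤ) : Memℓp (fun n => f (e n)) 2 := by
  have h2 : 0 < (2 : ℝ≥0∞).toReal := by norm_num
  rw [memℓp_gen_iff h2] at hf ⊢
  exact (e.summable_iff (f := fun n => ‖f n‖ ^ (2 : ℝ≥0∞).toReal)).2 hf

theorem memlp_two_mul {c : ℤ → ℝ} (hc : ∃ C : ℝ, ∀ n, |c n| ≤ C) {f : ℤ → ℂ} (hf : Memℓp f 2) :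
    Memℓp (fun n => (c n : ℂ) * f n) 2 := by
  obtain ⟨C, hC⟩ := hc
  have h2 : 0 < (2 : ℝ≥0∞).toReal := by norm_num
  rw [memℓp_gen_iff h2] at hf ⊢
  refine Summable.of_nonneg_of_le (fun n => by positivity) (fun n => ?_)
    (hf.mul_left (C ^ (2 : ℝ≥0∞).toReal))
  have hC0 : 0 ≤ C := (abs_nonneg _).trans (hC n)
  rw [← Real.mul_rpow hC0 (norm_nonneg _), norm_mul, Complex.norm_real, Real.norm_eq_abs]
  gcongr
  exact hC n

theorem jacobi_memlp {a b : ℤ → ℝ} (ha : ∃ C : ℝ, ∀ n, |a n| ≤ C) (hb : ∃ C : ℝ, ∀ n, |b n| ≤ C)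
    (u : EllTwo) :
    Memℓp (fun n : ℤ => (a (n - 1) : ℂ) * u (n - 1) + (a n : ℂ) * u (n + 1) + (b n : ℂ) * u n) 2 := by
  have hu : Memℓp (fun n : ℤ => u n) 2 := lp.memℓp u
  have h1 : Memℓp (fun n : ℤ => (a (n - 1) : ℂ) * u (n - 1)) 2 :=
    memlp_two_comp (memlp_two_mul ha hu) (Equiv.subRight 1)
  have h2 : Memℓp (fun n : ℤ => (a n : ℂ) * u (n + 1)) 2 :=
    memlp_two_mul ha (memlp_two_comp hu (Equiv.addRight 1))
  exact (h1.add h2).add (memlp_two_mul hb hu)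

/-- The Jacobi operator on the whole of `ℓ²(ℤ)` with bounded real coefficients `a`, `b`:
`(W u)(n) = a(n-1) u(n-1) + a(n) u(n+1) + b(n) u(n)`. -/
def jacobiOperator (a b : ℤ → ℝ) (ha : ∃ C : ℝ, ∀ n, |a n| ≤ C) (hb : ∃ C : ℝ, ∀ n, |b n| ≤ C) :
    EllTwo →ₗ[ℂ] EllTwo where
  toFun u := ⟨fun n : ℤ => (a (n - 1) : ℂ) * u (n - 1) + (a n : ℂ) * u (n + 1) + (b n : ℂ) * u n,
    jacobi_memlp ha hb u⟩
  map_add' u v := by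
    ext n
    simp only [lp.coeFn_add, Pi.add_apply]
    ring
  map_smul' c u := by
    ext n
    simp only [lp.coeFn_smul, Pi.smul_apply, smul_eq_mul, RingHom.id_apply]
    ring

/-- `G_γ(x) = ∫_2^x (E² - 4)^{1/2} (x - E)^{γ - 3/2} dE`. -/
noncomputable def jacobiG (γ x : ℝ) : ℝ :=
  ∫ E in (2 : ℝ)..x, (E ^ 2 - 4) ^ (1 / 2 : ℝ) * (x - E) ^ (γ - 3 / 2)

/-- The integral defining `jacobiG` converges for `γ > 1/2`. -/
theorem jacobiG_integrable {γ : ℝ} (hγ : 1 / 2 < γ) (x : ℝ) :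
    IntervalIntegrable (fun E : ℝ => (E ^ 2 - 4) ^ (1 / 2 : ℝ) * (x - E) ^ (γ - 3 / 2))
      MeasureTheory.volume 2 x := by
  have h : IntervalIntegrable (fun E : ℝ => (x - E) ^ (γ - 3 / 2)) MeasureTheory.volume 2 x := by
    have := (intervalIntegral.intervalIntegrable_rpow' (a := x - 2) (b := 0)
      (r := γ - 3 / 2) (by linarith)).comp_sub_left x
    simpa using this
  refine h.continuousOn_mul (Continuous.continuousOn ?_)
  exact (by fun_prop : Continuous fun E : ℝ => E ^ 2 - 4).rpow_const (fun _ => Or.inr (by norm_num))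

/-- The real eigenvalues of an operator on `ℓ²(ℤ)` that lie outside `[-2, 2]`. -/
def outerEigenvalues (W : EllTwo →ₗ[ℂ] EllTwo) : Set ℝ :=
  {l : ℝ | 2 < |l| ∧ Module.End.HasEigenvalue W (l : ℂ)}

/-! The argument is that of Hundertmark and Simon, followed by Aizenman–Lieb integration over a
threshold.

An off-diagonal deviation `a n + 1` costs at most its modulus on two diagonal sites, so as a form
`W` dominates the free operator with off-diagonal entries -1 and potential -V, where V(n) =
max(-b(n), 0) + |a(n)+1| + |a(n-1)+1|. The Green function of the free operator at -(μ + 1/μ) is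
μ^|n-m| / (1/μ - μ), and `birman_schwinger_bound` turns each eigenvalue below -2 into a lower bound
√(E² - 4) for the kernel √v(n) μ^|n-m| √v(m), with E = μ + 1/μ.

Different eigenvalues give different μ. The kernel at μ is an average of conjugates by sign matrices
of the kernel at any larger ν (`exists_sign_le`), so sums over orthonormal families can be carried
up to μ = 1. There the kernel has rank one and trace ∑ v. This yields `sum_sqrt_eigenvalues_le`: the
sum of √((-l-t)² - 4) over eigenvalues l < -2 - t is at most ∑ (V - t)₊.

Integrating against t^(γ - 3/2) produces `jacobiG` on the left and the Beta constant times V^(γ +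
1/2) on the right. Conjugation by (-1)^n reduces eigenvalues above 2 to those below -2, and
convexity separates the three terms of V. -/

/-! ### Jacobi operators as quadratic forms -/

theorem jacobiOperator_apply (a b : ℤ → ℝ) (ha : ∃ C : ℝ, ∀ n, |a n| ≤ C)
    (hb : ∃ C : ℝ, ∀ n, |b n| ≤ C) (u : EllTwo) (n : ℤ) :
    jacobiOperator a b ha hb u n =
      (a (n - 1) : ℂ) * u (n - 1) + (a n : ℂ) * u (n + 1) + (b n : ℂ) * u n := rfl

theorem EllTwo.summable_conj_mul {f g : ℤ → ℂ} (hf : Memℓp f 2) (hg : Memℓp g 2) :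
    Summable fun n => (starRingEnd ℂ) (f n) * g n := by
  have := lp.summable_inner (𝕜 := ℂ) (⟨f, hf⟩ : EllTwo) ⟨g, hg⟩
  simpa [RCLike.inner_apply, mul_comm] using this

theorem EllTwo.inner_eq_tsum (x y : EllTwo) :
    inner ℂ x y = ∑' n, (starRingEnd ℂ) (x n) * y n := by
  rw [lp.inner_eq_tsum]
  simp [RCLike.inner_apply, mul_comm]

theorem EllTwo.summable_norm_sq {f : ℤ → ℂ} (hf : Memℓp f 2) : Summable fun n => ‖f n‖ ^ 2 := by
  have h2 : 0 < (2 : ℝ≥0∞).toReal := by norm_num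
  rw [memℓp_gen_iff h2] at hf
  simpa using hf

theorem jacobiOperator_isSymmetric (a b : ℤ → ℝ) (ha : ∃ C : ℝ, ∀ n, |a n| ≤ C)
    (hb : ∃ C : ℝ, ∀ n, |b n| ≤ C) : (jacobiOperator a b ha hb).IsSymmetric := by
  intro x y
  have hx := lp.memℓp x
  have hy := lp.memℓp y
  have s1 : Summable fun n : ℤ => (starRingEnd ℂ) ((a n : ℂ) * x n) * y (n + 1) :=
    EllTwo.summable_conj_mul (memlp_two_mul ha hx) (memlp_two_comp hy (Equiv.addRight 1))
  have s2 : Summable fun n : ℤ => (starRingEnd ℂ) ((a n : ℂ) * x (n + 1)) * y n :=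
    EllTwo.summable_conj_mul (memlp_two_mul ha (memlp_two_comp hx (Equiv.addRight 1))) hy
  have s3 : Summable fun n : ℤ => (starRingEnd ℂ) ((b n : ℂ) * x n) * y n :=
    EllTwo.summable_conj_mul (memlp_two_mul hb hx) hy
  have s1' := (Equiv.subRight (1 : ℤ)).summable_iff.2 s1
  have s2' := (Equiv.subRight (1 : ℤ)).summable_iff.2 s2
  have e1 := (Equiv.subRight (1 : ℤ)).tsum_eq
    (fun n : ℤ => (starRingEnd ℂ) ((a n : ℂ) * x n) * y (n + 1))
  have e2 := (Equiv.subRight (1 : ℤ)).tsum_eq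
    (fun n : ℤ => (starRingEnd ℂ) ((a n : ℂ) * x (n + 1)) * y n)
  rw [EllTwo.inner_eq_tsum, EllTwo.inner_eq_tsum]
  have l1 : ∀ n : ℤ, (starRingEnd ℂ) (jacobiOperator a b ha hb x n) * y n =
      (((fun n : ℤ => (starRingEnd ℂ) ((a n : ℂ) * x n) * y (n + 1)) ∘ (Equiv.subRight (1 : ℤ))) n
        + (starRingEnd ℂ) ((a n : ℂ) * x (n + 1)) * y n)
        + (starRingEnd ℂ) ((b n : ℂ) * x n) * y n := by
    intro n
    simp [jacobiOperator_apply]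
    ring
  have l2 : ∀ n : ℤ, (starRingEnd ℂ) (x n) * jacobiOperator a b ha hb y n =
      (((fun n : ℤ => (starRingEnd ℂ) ((a n : ℂ) * x (n + 1)) * y n) ∘ (Equiv.subRight (1 : ℤ))) n
        + (starRingEnd ℂ) ((a n : ℂ) * x n) * y (n + 1))
        + (starRingEnd ℂ) ((b n : ℂ) * x n) * y n := by
    intro n
    simp [jacobiOperator_apply]
    ring
  simp_rw [l1, l2]
  rw [(s1'.add s2).tsum_add s3, s1'.tsum_add s2, (s2'.add s1).tsum_add s3, s2'.tsum_add s1]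
  simp only [Function.comp_apply]
  rw [e1, e2]
  ring

/-- A diagonally dominant Jacobi operator is nonnegative. -/
theorem jacobiOperator_re_inner_nonneg (a b : ℤ → ℝ) (ha : ∃ C : ℝ, ∀ n, |a n| ≤ C)
    (hb : ∃ C : ℝ, ∀ n, |b n| ≤ C) (hab : ∀ n, |a n| + |a (n - 1)| ≤ b n) (u : EllTwo) :
    0 ≤ (inner ℂ u (jacobiOperator a b ha hb u)).re := by
  have hu := lp.memℓp u
  have ss : Summable fun n : ℤ => |a n| * ‖u n‖ ^ 2 := by
    obtain ⟨C, hC⟩ := ha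
    refine Summable.of_nonneg_of_le (fun n => by positivity) (fun n => ?_)
      ((EllTwo.summable_norm_sq hu).mul_left C)
    gcongr
    exact hC n
  have st : Summable fun n : ℤ => |a n| * ‖u (n + 1)‖ ^ 2 := by
    obtain ⟨C, hC⟩ := ha
    refine Summable.of_nonneg_of_le (fun n => by positivity) (fun n => ?_)
      ((EllTwo.summable_norm_sq (memlp_two_comp hu (Equiv.addRight 1))).mul_left C)
    simp only [Equiv.coe_addRight]
    gcongr
    exact hC n
  have ss' := (Equiv.subRight (1 : ℤ)).summable_iff.2 ss
  have st' := (Equiv.subRight (1 : ℤ)).summable_iff.2 st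
  have es := (Equiv.subRight (1 : ℤ)).tsum_eq (fun n : ℤ => |a n| * ‖u n‖ ^ 2)
  have et := (Equiv.subRight (1 : ℤ)).tsum_eq (fun n : ℤ => |a n| * ‖u (n + 1)‖ ^ 2)
  have hmain : Summable fun n => (starRingEnd ℂ) (u n) * jacobiOperator a b ha hb u n :=
    EllTwo.summable_conj_mul hu (lp.memℓp _)
  have hre := (Complex.hasSum_re hmain.hasSum)
  rw [EllTwo.inner_eq_tsum, ← hre.tsum_eq]
  -- After the arithmetic–geometric mean inequality on both cross terms and diagonal dominance, what
  -- remains is a difference of shifted sequences whose total sum vanishes.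
  have hlow : ∀ n : ℤ, (1 / 2) * (((fun n : ℤ => |a n| * ‖u (n + 1)‖ ^ 2) ∘ Equiv.subRight (1 : ℤ)) n
      - ((fun n : ℤ => |a n| * ‖u n‖ ^ 2) ∘ Equiv.subRight (1 : ℤ)) n)
      + (1 / 2) * (|a n| * ‖u n‖ ^ 2 - |a n| * ‖u (n + 1)‖ ^ 2) ≤
      ((starRingEnd ℂ) (u n) * jacobiOperator a b ha hb u n).re := by
    intro n
    have key : ∀ (c : ℝ) (x y : ℂ), -(|c| * (‖x‖ ^ 2 + ‖y‖ ^ 2) / 2) ≤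
        ((starRingEnd ℂ) x * ((c : ℂ) * y)).re := by
      intro c x y
      have h1 : ‖(starRingEnd ℂ) x * ((c : ℂ) * y)‖ = |c| * (‖x‖ * ‖y‖) := by
        simp [Complex.norm_real]; ring
      have h2 := Complex.abs_re_le_norm ((starRingEnd ℂ) x * ((c : ℂ) * y))
      rw [h1] at h2
      have h3 := neg_le_of_abs_le h2
      have h4 : |c| * (‖x‖ * ‖y‖) ≤ |c| * ((‖x‖ ^ 2 + ‖y‖ ^ 2) / 2) := by
        gcongr
        nlinarith [sq_nonneg (‖x‖ - ‖y‖)]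
      linarith
    have k1 := key (a (n - 1)) (u n) (u (n - 1))
    have k2 := key (a n) (u n) (u (n + 1))
    have k3 : ((starRingEnd ℂ) (u n) * ((b n : ℂ) * u n)).re = b n * ‖u n‖ ^ 2 := by
      rw [mul_left_comm, Complex.re_ofReal_mul, Complex.conj_mul']
      norm_cast
    have k4 := mul_le_mul_of_nonneg_right (hab n) (sq_nonneg ‖u n‖)
    rw [jacobiOperator_apply, mul_add, mul_add, Complex.add_re, Complex.add_re, k3]
    simp only [Function.comp_apply, Equiv.subRight_apply, sub_add_cancel]
    linarith
  have hs1 := ((st'.sub ss').mul_left (1 / 2)).add ((ss.sub st).mul_left (1 / 2))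
  refine le_trans ?_ (hs1.tsum_le_tsum hlow hre.summable)
  rw [((st'.sub ss').mul_left (1 / 2)).tsum_add ((ss.sub st).mul_left (1 / 2)), tsum_mul_left,
    tsum_mul_left, st'.tsum_sub ss', ss.tsum_sub st]
  simp only [Function.comp_apply]
  rw [es, et]
  linarith

/-- The difference of the two operators is again a Jacobi operator, and the hypothesis makes it
diagonally dominant. This is how `a` is traded for the constant -1 at the expense of the diagonal.
-/
theorem jacobiOperator_re_inner_mono {a₁ b₁ a₂ b₂ : ℤ → ℝ} (ha₁ : ∃ C : ℝ, ∀ n, |a₁ n| ≤ C)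
    (hb₁ : ∃ C : ℝ, ∀ n, |b₁ n| ≤ C) (ha₂ : ∃ C : ℝ, ∀ n, |a₂ n| ≤ C)
    (hb₂ : ∃ C : ℝ, ∀ n, |b₂ n| ≤ C)
    (h : ∀ n, b₁ n + |a₂ n - a₁ n| + |a₂ (n - 1) - a₁ (n - 1)| ≤ b₂ n) (u : EllTwo) :
    (inner ℂ u (jacobiOperator a₁ b₁ ha₁ hb₁ u)).re ≤
      (inner ℂ u (jacobiOperator a₂ b₂ ha₂ hb₂ u)).re := by
  have bsub : ∀ {f g : ℤ → ℝ}, (∃ C : ℝ, ∀ n, |f n| ≤ C) → (∃ C : ℝ, ∀ n, |g n| ≤ C) →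
      ∃ C : ℝ, ∀ n, |f n - g n| ≤ C := by
    rintro f g ⟨C, hC⟩ ⟨D, hD⟩
    exact ⟨C + D, fun n => (abs_sub _ _).trans (add_le_add (hC n) (hD n))⟩
  have := jacobiOperator_re_inner_nonneg (fun n => a₂ n - a₁ n) (fun n => b₂ n - b₁ n)
    (bsub ha₂ ha₁) (bsub hb₂ hb₁) (fun n => by linarith [h n]) u
  have e : jacobiOperator (fun n => a₂ n - a₁ n) (fun n => b₂ n - b₁ n)
    (bsub ha₂ ha₁) (bsub hb₂ hb₁) u = jacobiOperator a₂ b₂ ha₂ hb₂ u - jacobiOperator a₁ b₁ ha₁ hb₁ u := by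
    ext n
    simp only [lp.coeFn_sub, Pi.sub_apply, jacobiOperator_apply]
    push_cast
    ring
  rw [e, inner_sub_right, Complex.sub_re] at this
  linarith

/-! ### The free Green function and the Birman–Schwinger inequality -/

theorem memlp_two_pow_natAbs {μ : ℝ} (h0 : 0 ≤ μ) (h1 : μ < 1) :
    Memℓp (fun n : ℤ => (μ : ℂ) ^ n.natAbs) 2 := by
  have h2 : 0 < (2 : ℝ≥0∞).toReal := by norm_num
  rw [memℓp_gen_iff h2]
  have hs : Summable fun n : ℕ => (μ ^ 2) ^ n :=
    summable_geometric_of_lt_one (by positivity) (by nlinarith)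
  have e : ∀ n : ℤ, ‖(μ : ℂ) ^ n.natAbs‖ ^ (2 : ℝ≥0∞).toReal = (μ ^ 2) ^ n.natAbs := by
    intro n
    simp only [norm_pow, Complex.norm_real, Real.norm_eq_abs, abs_of_nonneg h0,
      ENNReal.toReal_ofNat, Real.rpow_ofNat]
    rw [← pow_mul, ← pow_mul, mul_comm]
  simp_rw [e]
  exact Summable.of_nat_of_neg (by simpa using hs) (by simpa using hs)

/-- Away from 0 both geometric branches solve the recurrence, since μ and 1/μ are its characteristic
roots; the kink at 0 produces the delta. Hence μ^|n| / (1/μ - μ) is the free Green function. -/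
theorem pow_natAbs_three_term {μ : ℝ} (h0 : 0 < μ) (n : ℤ) :
    -μ ^ (n - 1).natAbs - μ ^ (n + 1).natAbs + (μ + 1 / μ) * μ ^ n.natAbs =
      if n = 0 then 1 / μ - μ else 0 := by
  rcases lt_trichotomy n 0 with h | rfl | h
  · obtain ⟨k, rfl⟩ : ∃ k : ℕ, n = -(k + 1) := ⟨(-n - 1).toNat, by omega⟩
    rw [show (-((k : ℤ) + 1) - 1).natAbs = k + 2 by omega,
      show (-((k : ℤ) + 1) + 1).natAbs = k by omega,
      show (-((k : ℤ) + 1)).natAbs = k + 1 by omega, if_neg h.ne]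
    field_simp
    ring
  · simp
    ring
  · obtain ⟨k, rfl⟩ : ∃ k : ℕ, n = k + 1 := ⟨(n - 1).toNat, by omega⟩
    rw [show ((k : ℤ) + 1 - 1).natAbs = k by omega,
      show ((k : ℤ) + 1 + 1).natAbs = k + 2 by omega,
      show ((k : ℤ) + 1).natAbs = k + 1 by omega, if_neg h.ne']
    field_simp
    ring

/-- The solution of `-g(n-1) - g(n+1) + (μ + 1/μ) g(n) = (1/μ - μ) f(n)` for `f` supported in `T`. -/
noncomputable def greenSum (μ : ℝ) (h0 : 0 ≤ μ) (h1 : μ < 1) (T : Finset ℤ) (f : ℤ → ℂ) : EllTwo :=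
  ⟨fun n => ∑ m ∈ T, f m * (μ : ℂ) ^ (n - m).natAbs, by
    have := Memℓp.finsetSum (E := fun _ : ℤ => ℂ) (p := 2) T
      (f := fun m n => f m * (μ : ℂ) ^ (n - m).natAbs)
      (fun m _ => (memlp_two_comp (memlp_two_pow_natAbs h0 h1) (Equiv.subRight m)).const_mul (f m))
    exact this⟩

theorem jacobiOperator_greenSum {μ : ℝ} (h0 : 0 < μ) (h1 : μ < 1) (T : Finset ℤ) (f : ℤ → ℂ)
    (ha : ∃ C : ℝ, ∀ _ : ℤ, |(-1 : ℝ)| ≤ C) (hb : ∃ C : ℝ, ∀ _ : ℤ, |μ + 1 / μ| ≤ C)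
    (hf : ∀ n, n ∉ T → f n = 0) (n : ℤ) :
    jacobiOperator (fun _ => -1) (fun _ => μ + 1 / μ) ha hb (greenSum μ h0.le h1 T f) n =
      ((1 / μ - μ : ℝ) : ℂ) * f n := by
  rw [jacobiOperator_apply]
  simp only [greenSum, Finset.mul_sum, ← Finset.sum_add_distrib]
  have e : ∀ m ∈ T, ((-1 : ℝ) : ℂ) * (f m * (μ : ℂ) ^ (n - 1 - m).natAbs) +
      ((-1 : ℝ) : ℂ) * (f m * (μ : ℂ) ^ (n + 1 - m).natAbs) +
      ((μ + 1 / μ : ℝ) : ℂ) * (f m * (μ : ℂ) ^ (n - m).natAbs) =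
      if n = m then ((1 / μ - μ : ℝ) : ℂ) * f m else 0 := by
    intro m _
    have := congrArg (fun x : ℝ => (x : ℂ)) (pow_natAbs_three_term h0 (n - m))
    rw [show n - m - 1 = n - 1 - m by ring, show n - m + 1 = n + 1 - m by ring] at this
    simp only [sub_eq_zero] at this
    split_ifs with h
    · rw [if_pos h] at this
      rw [← this]
      push_cast
      ring
    · rw [if_neg h] at this
      rw [← mul_zero (f m), ← Complex.ofReal_zero, ← this]
      push_cast
      ring
  rw [Finset.sum_congr rfl e, Finset.sum_ite_eq]
  split_ifs with h
  · rfl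
  · rw [hf n h, mul_zero]

/-- The Birman–Schwinger bound for the free Jacobi operator with a finitely supported potential. -/
theorem birman_schwinger_bound {μ : ℝ} (h0 : 0 < μ) (h1 : μ < 1) (T : Finset ℤ) (v : ℤ → ℝ)
    (hvT : ∀ n, n ∉ T → v n = 0)
    (ha : ∃ C : ℝ, ∀ _ : ℤ, |(-1 : ℝ)| ≤ C) (hb : ∃ C : ℝ, ∀ n : ℤ, |μ + 1 / μ - v n| ≤ C)
    (u : EllTwo)
    (hu : (inner ℂ u (jacobiOperator (fun _ => -1) (fun n => μ + 1 / μ - v n) ha hb u)).re ≤ 0) :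
    (1 / μ - μ) * ∑ n ∈ T, v n * ‖u n‖ ^ 2 ≤
      ∑ n ∈ T, ∑ m ∈ T, v n * v m * μ ^ (n - m).natAbs * ((starRingEnd ℂ) (u n) * u m).re := by
  have hc : 0 < 1 / μ - μ := by
    have : 1 < 1 / μ := by rw [lt_div_iff₀ h0]; linarith
    linarith
  set c : ℝ := 1 / μ - μ with hcdef
  have hE : 2 ≤ μ + 1 / μ := by
    have : μ + 1 / μ - 2 = (1 - μ) ^ 2 / μ := by field_simp; ring
    have h2 : 0 ≤ (1 - μ) ^ 2 / μ := by positivity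
    linarith
  have hb' : ∃ C : ℝ, ∀ _ : ℤ, |μ + 1 / μ| ≤ C := ⟨_, fun _ => le_rfl⟩
  have hvb : ∃ C : ℝ, ∀ n, |v n| ≤ C := by
    obtain ⟨C, hC⟩ := hb
    refine ⟨|μ + 1 / μ| + C, fun n => ?_⟩
    have := abs_sub (μ + 1 / μ) (μ + 1 / μ - v n)
    rw [sub_sub_cancel] at this
    exact this.trans (by gcongr; exact hC n)
  set G := jacobiOperator (fun _ => -1) (fun _ => μ + 1 / μ) ha hb' with hG
  have hGs : G.IsSymmetric := jacobiOperator_isSymmetric _ _ _ _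
  let F : EllTwo := ⟨fun n => (v n : ℂ) * u n, memlp_two_mul hvb (lp.memℓp u)⟩
  have hF : ∀ n, F n = (v n : ℂ) * u n := fun _ => rfl
  set g := greenSum μ h0.le h1 T F with hg
  have hgn : ∀ n, g n = ∑ m ∈ T, (v m : ℂ) * u m * (μ : ℂ) ^ (n - m).natAbs := fun _ => rfl
  have hGg : G g = (c : ℂ) • F := by
    ext n
    exact jacobiOperator_greenSum h0 h1 T F ha hb' (fun n hn => by rw [hF, hvT n hn]; simp) n
  -- Nonnegativity of `G` at `c • u - g`, where `g` is `c` times a preimage of `F` under `G`,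
  -- replaces the Cauchy–Schwarz inequality with G^(1/2) and G^(-1/2). Combined with ⟨u, Gu⟩ ≤ ⟨u,
  -- F⟩ it leaves c⟨u, F⟩ ≤ ⟨g, F⟩.
  have hpos : 0 ≤ (inner ℂ ((c : ℂ) • u - g) (G ((c : ℂ) • u - g))).re :=
    jacobiOperator_re_inner_nonneg _ _ _ _ (fun _ => by norm_num; norm_num at hE; exact hE) _
  have hsplit : jacobiOperator (fun _ => -1) (fun n => μ + 1 / μ - v n) ha hb u = G u - F := by
    ext n
    simp only [hG, lp.coeFn_sub, Pi.sub_apply, jacobiOperator_apply, hF]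
    push_cast
    ring
  rw [hsplit, inner_sub_right, Complex.sub_re] at hu
  have hgu : inner ℂ g (G u) = (c : ℂ) * inner ℂ F u := by
    rw [← hGs g u, hGg, inner_smul_left, Complex.conj_ofReal]
  have hFu : (inner ℂ F u).re = (inner ℂ u F).re := by
    rw [← inner_conj_symm, Complex.conj_re]
  rw [map_sub, map_smul, hGg, inner_sub_left, inner_sub_right, inner_sub_right] at hpos
  simp only [inner_smul_left, inner_smul_right, hgu, Complex.conj_ofReal, Complex.sub_re,
    Complex.re_ofReal_mul, hFu] at hpos
  have hmain : c * (inner ℂ u F).re ≤ (inner ℂ g F).re := by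
    have : 0 ≤ c * ((inner ℂ g F).re - c * (inner ℂ u F).re) := by nlinarith [mul_pos hc hc]
    have := nonneg_of_mul_nonneg_right this hc
    linarith
  have e1 : (inner ℂ u F).re = ∑ n ∈ T, v n * ‖u n‖ ^ 2 := by
    rw [EllTwo.inner_eq_tsum, tsum_eq_sum (s := T) (fun n hn => by rw [hF, hvT n hn]; simp),
      Complex.re_sum]
    refine Finset.sum_congr rfl fun n _ => ?_
    rw [hF, mul_left_comm, Complex.re_ofReal_mul, Complex.conj_mul']
    norm_cast
  have e2 : (inner ℂ g F).re = ∑ n ∈ T, ∑ m ∈ T,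
      v n * v m * μ ^ (n - m).natAbs * ((starRingEnd ℂ) (u n) * u m).re := by
    rw [EllTwo.inner_eq_tsum, tsum_eq_sum (s := T) (fun n hn => by rw [hF, hvT n hn]; simp),
      Complex.re_sum]
    refine Finset.sum_congr rfl fun n _ => ?_
    rw [hgn, hF, map_sum, Finset.sum_mul, Complex.re_sum]
    refine Finset.sum_congr rfl fun m _ => ?_
    have : (starRingEnd ℂ) ((v m : ℂ) * u m * (μ : ℂ) ^ (n - m).natAbs) * ((v n : ℂ) * u n) =
        ((v n * v m * μ ^ (n - m).natAbs : ℝ) : ℂ) * ((starRingEnd ℂ) (u m) * u n) := by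
      simp
      ring
    rw [this, Complex.re_ofReal_mul]
    simp
    ring_nf
    simp
  rw [e1, e2] at hmain
  exact hmain

/-! ### The exponential kernel as an average of sign kernels -/

/-- Raising the clamp from K to K + 1 shortens the gap by one exactly when K separates the two
points. The bracket equals r in that case and 1 otherwise; it is a convex combination of the trivial
sign kernel and the one that changes sign at K. -/
theorem pow_natAbs_max_step (r : ℝ) (K n m : ℤ) :
    r ^ (max n K - max m K).natAbs =
      ((1 + r) / 2 + (1 - r) / 2 * ((if n ≤ K then -1 else 1) * (if m ≤ K then -1 else 1))) *
        r ^ (max n (K + 1) - max m (K + 1)).natAbs := by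
  by_cases hn : n ≤ K <;> by_cases hm : m ≤ K
  · rw [max_eq_right hn, max_eq_right hm, max_eq_right (by omega : n ≤ K + 1),
      max_eq_right (by omega : m ≤ K + 1), if_pos hn, if_pos hm]
    simp
    ring
  · rw [max_eq_right hn, max_eq_left (by omega : K ≤ m), max_eq_right (by omega : n ≤ K + 1),
      max_eq_left (by omega : K + 1 ≤ m), if_pos hn, if_neg hm,
      show (K - m).natAbs = (K + 1 - m).natAbs + 1 by omega, pow_succ]
    ring
  · rw [max_eq_left (by omega : K ≤ n), max_eq_right hm, max_eq_left (by omega : K + 1 ≤ n),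
      max_eq_right (by omega : m ≤ K + 1), if_neg hn, if_pos hm,
      show (n - K).natAbs = (n - (K + 1)).natAbs + 1 by omega, pow_succ]
    ring
  · rw [max_eq_left (by omega : K ≤ n), max_eq_left (by omega : K ≤ m),
      max_eq_left (by omega : K + 1 ≤ n), max_eq_left (by omega : K + 1 ≤ m), if_neg hn, if_neg hm]
    ring

/-- The kernel `r ^ |n - m|` is an average of the rank-one kernels given by sign sequences; hence
some sign sequence does at least as well as the kernel. -/
theorem exists_sign_le {ι : Type*} [Fintype ι] (p : ι → ℤ) (C : ι → ι → ℝ) {r : ℝ}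
    (h0 : 0 ≤ r) (h1 : r ≤ 1) :
    ∃ s : ι → ℝ, (∀ i, s i * s i = 1) ∧
      ∑ i, ∑ k, C i k * r ^ (p i - p k).natAbs ≤ ∑ i, ∑ k, C i k * (s i * s k) := by
  obtain ⟨M, hM⟩ : ∃ M : ℕ, ∀ i, (p i).natAbs ≤ M :=
    ⟨∑ i, (p i).natAbs, fun i => Finset.single_le_sum (f := fun i => (p i).natAbs)
      (fun _ _ => Nat.zero_le _) (Finset.mem_univ i)⟩
  -- Clamping at -M changes no point, so the induction starts from the full kernel. At k = 2M every
  -- point is clamped to M and the kernel is identically 1, leaving only the signs.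
  have key : ∀ k : ℕ, ∃ s : ι → ℝ, (∀ i, s i * s i = 1) ∧
      ∑ i, ∑ j, C i j * r ^ (p i - p j).natAbs ≤ ∑ i, ∑ j, C i j * (s i * s j) *
        r ^ (max (p i) (-M + k) - max (p j) (-M + k)).natAbs := by
    intro k
    induction k with
    | zero =>
      refine ⟨fun _ => 1, fun _ => by norm_num, le_of_eq ?_⟩
      refine Finset.sum_congr rfl fun i _ => Finset.sum_congr rfl fun j _ => ?_
      have hi := hM i
      have hj := hM j
      rw [max_eq_left (by push_cast; omega), max_eq_left (by push_cast; omega)]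
      ring
    | succ k ih =>
      obtain ⟨s, hs, hle⟩ := ih
      set K : ℤ := -M + k with hK
      have hK1 : (-M + (k + 1 : ℕ) : ℤ) = K + 1 := by push_cast; omega
      rw [hK1]
      let d : ι → ℝ := fun i => if p i ≤ K then -1 else 1
      have hd : ∀ i, d i * d i = 1 := fun i => by
        by_cases h : p i ≤ K <;> simp [d, h]
      let S : (ι → ℝ) → ℝ := fun s => ∑ i, ∑ j, C i j * (s i * s j) *
        r ^ (max (p i) (K + 1) - max (p j) (K + 1)).natAbs
      have hsplit : ∑ i, ∑ j, C i j * (s i * s j) * r ^ (max (p i) K - max (p j) K).natAbs =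
          (1 + r) / 2 * S s + (1 - r) / 2 * S (fun i => s i * d i) := by
        simp only [S, Finset.mul_sum, ← Finset.sum_add_distrib]
        refine Finset.sum_congr rfl fun i _ => Finset.sum_congr rfl fun j _ => ?_
        rw [pow_natAbs_max_step r K (p i) (p j)]
        simp only [d]
        ring
      rw [hsplit] at hle
      -- The left side is bounded by a convex combination of two values of `S`, so the larger of the
      -- two can be kept.
      rcases le_total (S s) (S fun i => s i * d i) with h | h
      · refine ⟨fun i => s i * d i, fun i => ?_, hle.trans ?_⟩
        · rw [mul_mul_mul_comm, hs, hd, one_mul]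
        · change _ ≤ S fun i => s i * d i
          nlinarith
      · refine ⟨s, hs, hle.trans ?_⟩
        change _ ≤ S s
        nlinarith
  obtain ⟨s, hs, hle⟩ := key (2 * M)
  refine ⟨s, hs, hle.trans (le_of_eq ?_)⟩
  refine Finset.sum_congr rfl fun i _ => Finset.sum_congr rfl fun j _ => ?_
  have hi := hM i
  have hj := hM j
  rw [max_eq_right (by push_cast; omega), max_eq_right (by push_cast; omega)]
  simp

/-! ### A Ky Fan argument for kernels varying with μ -/

/-- The quadratic form of the matrix `σ_i μ ^ |p_i - p_k| σ_k`. -/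
noncomputable def expForm {ι : Type*} [Fintype ι] (p : ι → ℤ) (σ : ι → ℝ) (μ : ℝ)
    (w : EuclideanSpace ℂ ι) : ℝ :=
  ∑ i, ∑ k, σ i * σ k * μ ^ (p i - p k).natAbs * ((starRingEnd ℂ) (w i) * w k).re

theorem expForm_one {ι : Type*} [Fintype ι] (p : ι → ℤ) (σ : ι → ℝ) (w : EuclideanSpace ℂ ι) :
    expForm p σ 1 w = ‖inner ℂ w (WithLp.toLp 2 fun i => (σ i : ℂ) : EuclideanSpace ℂ ι)‖ ^ 2 := by
  have h : inner ℂ w (WithLp.toLp 2 fun i => (σ i : ℂ) : EuclideanSpace ℂ ι) =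
      ∑ i, (σ i : ℂ) * (starRingEnd ℂ) (w i) := by
    simp [PiLp.inner_apply, RCLike.inner_apply]
  have h2 : (‖∑ i, (σ i : ℂ) * (starRingEnd ℂ) (w i)‖ ^ 2 : ℝ) =
      ((∑ i, (σ i : ℂ) * (starRingEnd ℂ) (w i)) *
        (starRingEnd ℂ) (∑ i, (σ i : ℂ) * (starRingEnd ℂ) (w i))).re := by
    rw [Complex.mul_conj']
    norm_cast
  rw [h, h2, map_sum, Finset.sum_mul_sum, expForm, Complex.re_sum]
  refine Finset.sum_congr rfl fun i _ => ?_
  rw [Complex.re_sum]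
  refine Finset.sum_congr rfl fun k _ => ?_
  have : (σ i : ℂ) * (starRingEnd ℂ) (w i) * (starRingEnd ℂ) ((σ k : ℂ) * (starRingEnd ℂ) (w k)) =
      ((σ i * σ k : ℝ) : ℂ) * ((starRingEnd ℂ) (w i) * w k) := by
    simp
    ring
  rw [this, Complex.re_ofReal_mul]
  simp

/-- Since μ^k = (μ/ν)^k ν^k, the sign lemma applies with r = μ/ν and the remaining factors as
coefficients. Multiplying coordinates by signs is unitary, so orthonormality survives. -/
theorem exists_orthonormal_expForm_mono {ι : Type*} [Fintype ι] (p : ι → ℤ) (σ : ι → ℝ) {μ ν : ℝ}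
    (h0 : 0 ≤ μ) (hμν : μ ≤ ν) (hν : 0 < ν) (J : Finset ℝ) (v : ℝ → EuclideanSpace ℂ ι)
    (hv : ∀ i ∈ J, ∀ k ∈ J, inner ℂ (v i) (v k) = if i = k then (1 : ℂ) else 0) :
    ∃ w : ℝ → EuclideanSpace ℂ ι,
      (∀ i ∈ J, ∀ k ∈ J, inner ℂ (w i) (w k) = if i = k then (1 : ℂ) else 0) ∧
      ∑ j ∈ J, expForm p σ μ (v j) ≤ ∑ j ∈ J, expForm p σ ν (w j) := by
  obtain ⟨s, hs, hle⟩ := exists_sign_le p (fun i k => ∑ j ∈ J, σ i * σ k * ν ^ (p i - p k).natAbs *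
    ((starRingEnd ℂ) (v j i) * v j k).re) (div_nonneg h0 hν.le) ((div_le_one hν).2 hμν)
  refine ⟨fun j => WithLp.toLp 2 fun i => (s i : ℂ) * v j i, fun i hi k hk => ?_, ?_⟩
  · rw [← hv i hi k hk, PiLp.inner_apply, PiLp.inner_apply]
    refine Finset.sum_congr rfl fun n _ => ?_
    have := congrArg (fun x : ℝ => (x : ℂ)) (hs n)
    push_cast at this
    simp only [RCLike.inner_apply, map_mul, Complex.conj_ofReal]
    linear_combination (v k n * (starRingEnd ℂ) (v i n)) * this
  · convert hle using 1
    · simp only [expForm, Finset.sum_mul]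
      rw [Finset.sum_comm]
      refine Finset.sum_congr rfl fun i _ => ?_
      rw [Finset.sum_comm]
      refine Finset.sum_congr rfl fun k _ => Finset.sum_congr rfl fun j _ => ?_
      rw [div_pow]
      field_simp
    · simp only [expForm, Finset.sum_mul]
      rw [Finset.sum_comm]
      refine Finset.sum_congr rfl fun i _ => ?_
      rw [Finset.sum_comm]
      refine Finset.sum_congr rfl fun k _ => Finset.sum_congr rfl fun j _ => ?_
      have : (starRingEnd ℂ) ((s i : ℂ) * v j i) * ((s k : ℂ) * v j k) =
          ((s i * s k : ℝ) : ℂ) * ((starRingEnd ℂ) (v j i) * v j k) := by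
        simp
        ring
      rw [this, Complex.re_ofReal_mul]
      ring

/-- A dimension count: the span has dimension |S| + 1 and there are only |S| orthogonality
conditions. -/
theorem exists_normalized_combination {ι : Type*} [Fintype ι] {a : ℝ} {S : Finset ℝ} (ha : a ∉ S)
    (x v : ℝ → EuclideanSpace ℂ ι)
    (hx : ∀ c : ℝ → ℂ, ∑ i ∈ insert a S, c i • x i = 0 → ∀ i ∈ insert a S, c i = 0) :
    ∃ c : ℝ → ℂ, ‖∑ i ∈ insert a S, c i • x i‖ = 1 ∧
      ∀ k ∈ S, inner ℂ (v k) (∑ i ∈ insert a S, c i • x i) = 0 := by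
  let E : (↥(insert a S) → ℂ) →ₗ[ℂ] EuclideanSpace ℂ ι :=
    Fintype.linearCombination ℂ (fun i : ↥(insert a S) => x i)
  let Φ : (↥(insert a S) → ℂ) →ₗ[ℂ] (S → ℂ) :=
    LinearMap.pi fun k : S => (innerₛₗ ℂ (v k)).comp E
  have hker : LinearMap.ker Φ ≠ ⊥ := by
    refine LinearMap.ker_ne_bot_of_finrank_lt ?_
    simp [Finset.card_insert_of_notMem ha]
  obtain ⟨c, hc, hc0⟩ := (Submodule.ne_bot_iff _).1 hker
  let c' : ℝ → ℂ := fun i => if h : i ∈ insert a S then c ⟨i, h⟩ else 0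
  have hE : E c = ∑ i ∈ insert a S, c' i • x i := by
    rw [Fintype.linearCombination_apply, ← Finset.sum_coe_sort (insert a S)]
    refine Finset.sum_congr rfl fun i _ => ?_
    simp only [c', dif_pos i.2]
  have hne : E c ≠ 0 := by
    intro h0
    apply hc0
    funext i
    have := hx c' (hE ▸ h0) i i.2
    simp only [c', dif_pos i.2] at this
    exact this
  have hsum : ∑ i ∈ insert a S, ((‖E c‖⁻¹ : ℝ) * c' i : ℂ) • x i = ((‖E c‖⁻¹ : ℝ) : ℂ) • E c := by
    rw [hE, Finset.smul_sum]
    simp only [smul_smul]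
  refine ⟨fun i => (‖E c‖⁻¹ : ℝ) * c' i, ?_, fun k hk => ?_⟩
  · rw [hsum, norm_smul, Complex.norm_real, norm_inv, norm_norm,
      inv_mul_cancel₀ (norm_ne_zero_iff.2 hne)]
  · rw [hsum, inner_smul_right]
    have := congrFun (LinearMap.mem_ker.1 hc) ⟨k, hk⟩
    have h2 : inner ℂ (v k) (E c) = 0 := this
    rw [h2, mul_zero]

/-- A Ky Fan type bound: along an increasing family of the forms `expForm p σ μ` lower bounds
on the members of a flag of subspaces add up. -/
theorem sum_le_of_expForm_flag {ι : Type*} [Fintype ι] (p : ι → ℤ) (σ : ι → ℝ) (μ e : ℝ → ℝ)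
    (x : ℝ → EuclideanSpace ℂ ι) (J : Finset ℝ)
    (hμ : ∀ i ∈ J, ∀ k ∈ J, i ≤ k → μ i ≤ μ k) (hμ0 : ∀ i ∈ J, 0 < μ i)
    (hx : ∀ j ∈ J, ∀ S ⊆ J, (∀ i ∈ S, i ≤ j) → ∀ c : ℝ → ℂ,
      e j * ‖∑ i ∈ S, c i • x i‖ ^ 2 ≤ expForm p σ (μ j) (∑ i ∈ S, c i • x i) ∧
        (∑ i ∈ S, c i • x i = 0 → ∀ i ∈ S, c i = 0)) :
    ∀ ν : ℝ, 0 < ν → (∀ j ∈ J, μ j ≤ ν) → ∃ v : ℝ → EuclideanSpace ℂ ι,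
      (∀ i ∈ J, ∀ k ∈ J, inner ℂ (v i) (v k) = if i = k then (1 : ℂ) else 0) ∧
      ∑ j ∈ J, e j ≤ ∑ j ∈ J, expForm p σ ν (v j) := by
  induction J using Finset.induction_on_max with
  | empty => exact fun _ _ _ => ⟨0, by simp, by simp⟩
  | insert a S hlt ih =>
    intro ν hν hle
    have haS : a ∉ S := fun h => lt_irrefl _ (hlt a h)
    have hsub : S ⊆ insert a S := Finset.subset_insert a S
    have haJ : a ∈ insert a S := Finset.mem_insert_self a S
    -- The induction hypothesis is used at ν = μ a. The sign changes may have moved the vectors `v`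
    -- out of the flag, so the new vector is chosen in the span of all `x i` and orthogonal to them.
    obtain ⟨v, hv, hve⟩ := ih (fun i hi k hk => hμ i (hsub hi) k (hsub hk))
      (fun i hi => hμ0 i (hsub hi)) (fun j hj T hT => hx j (hsub hj) T (hT.trans hsub))
      (μ a) (hμ0 a haJ) (fun j hj => hμ j (hsub hj) a haJ (hlt j hj).le)
    have hxa := hx a haJ (insert a S) subset_rfl (by
      intro i hi
      rcases Finset.mem_insert.1 hi with rfl | hi
      · exact le_rfl
      · exact (hlt i hi).le)
    obtain ⟨c, hc1, hc2⟩ := exists_normalized_combination haS x v (fun c => (hxa c).2)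
    set f := ∑ i ∈ insert a S, c i • x i with hf
    have hfe : e a ≤ expForm p σ (μ a) f := by
      have := (hxa c).1
      rwa [← hf, hc1, one_pow, mul_one] at this
    let w : ℝ → EuclideanSpace ℂ ι := Function.update v a f
    have hwa : w a = f := Function.update_self ..
    have hwS : ∀ i ∈ S, w i = v i := fun i hi =>
      Function.update_of_ne (hlt i hi).ne _ _
    have hw : ∀ i ∈ insert a S, ∀ k ∈ insert a S,
        inner ℂ (w i) (w k) = if i = k then (1 : ℂ) else 0 := by
      intro i hi k hk
      rcases Finset.mem_insert.1 hi with hia | hi' <;> rcases Finset.mem_insert.1 hk with hka | hk'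
      · rw [hia, hka, if_pos rfl, hwa, inner_self_eq_norm_sq_to_K, hc1]
        simp
      · rw [hia, if_neg (hlt k hk').ne', hwa, hwS k hk', ← inner_conj_symm, hc2 k hk', map_zero]
      · rw [hka, if_neg (hlt i hi').ne, hwa, hwS i hi', hc2 i hi']
      · rw [hwS i hi', hwS k hk', hv i hi' k hk']
    obtain ⟨w', hw', hwe⟩ := exists_orthonormal_expForm_mono p σ (hμ0 a haJ).le (hle a haJ) hν
      (insert a S) w hw
    refine ⟨w', hw', le_trans ?_ hwe⟩
    rw [Finset.sum_insert haS, Finset.sum_insert haS, hwa,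
      Finset.sum_congr rfl (fun i hi => by rw [hwS i hi] :
        ∀ i ∈ S, expForm p σ (μ a) (w i) = expForm p σ (μ a) (v i))]
    exact add_le_add hfe hve

/-- At ν = 1 the form is w ↦ |⟨w, σ⟩|², and Bessel's inequality bounds its sum over an orthonormal
family by ‖σ‖². -/
theorem sum_le_sum_sq_of_expForm_flag {ι : Type*} [Fintype ι] (p : ι → ℤ) (σ : ι → ℝ)
    (μ e : ℝ → ℝ) (x : ℝ → EuclideanSpace ℂ ι) (J : Finset ℝ)
    (hμ : ∀ i ∈ J, ∀ k ∈ J, i ≤ k → μ i ≤ μ k) (hμ0 : ∀ i ∈ J, 0 < μ i) (hμ1 : ∀ i ∈ J, μ i ≤ 1)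
    (hx : ∀ j ∈ J, ∀ S ⊆ J, (∀ i ∈ S, i ≤ j) → ∀ c : ℝ → ℂ,
      e j * ‖∑ i ∈ S, c i • x i‖ ^ 2 ≤ expForm p σ (μ j) (∑ i ∈ S, c i • x i) ∧
        (∑ i ∈ S, c i • x i = 0 → ∀ i ∈ S, c i = 0)) :
    ∑ j ∈ J, e j ≤ ∑ i, σ i ^ 2 := by
  obtain ⟨v, hv, hve⟩ := sum_le_of_expForm_flag p σ μ e x J hμ hμ0 hx 1 one_pos hμ1
  refine hve.trans ?_
  simp_rw [expForm_one]
  have hon : Orthonormal ℂ (fun i : J => v i) := by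
    rw [orthonormal_iff_ite]
    intro i k
    rw [hv i i.2 k k.2]
    simp only [Subtype.ext_iff]
  have := hon.sum_inner_products_le (s := Finset.univ)
    (WithLp.toLp 2 fun i => (σ i : ℂ) : EuclideanSpace ℂ ι)
  rw [Finset.sum_coe_sort J (fun j => ‖inner ℂ (v j)
    (WithLp.toLp 2 fun i => (σ i : ℂ) : EuclideanSpace ℂ ι)‖ ^ 2)] at this
  refine this.trans (le_of_eq ?_)
  rw [EuclideanSpace.norm_sq_eq]
  simp

/-! ### The half-power eigenvalue bound above a threshold -/

/-- The root in `(0, 1)` of `μ + 1/μ = E`. -/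
noncomputable def decayRate (E : ℝ) : ℝ := (E - √(E ^ 2 - 4)) / 2

theorem decayRate_pos {E : ℝ} (hE : 2 < E) : 0 < decayRate E := by
  have : √(E ^ 2 - 4) < E := by
    rw [Real.sqrt_lt' (by linarith)]
    linarith
  unfold decayRate
  linarith

theorem decayRate_inv {E : ℝ} (hE : 2 < E) : 1 / decayRate E = (E + √(E ^ 2 - 4)) / 2 := by
  have h := decayRate_pos hE
  rw [div_eq_iff h.ne', decayRate]
  have := Real.sq_sqrt (by nlinarith : 0 ≤ E ^ 2 - 4)
  linarith

theorem decayRate_anti {E E' : ℝ} (hE : 2 < E) (h : E ≤ E') : decayRate E' ≤ decayRate E := by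
  have h1 := decayRate_pos hE
  have h2 := decayRate_pos (hE.trans_le h)
  rw [← one_div_le_one_div h1 h2, decayRate_inv hE, decayRate_inv (hE.trans_le h)]
  gcongr

theorem decayRate_lt_one {E : ℝ} (hE : 2 < E) : decayRate E < 1 := by
  have h := decayRate_inv hE
  have h1 : 1 < 1 / decayRate E := by
    rw [h]
    linarith [Real.sqrt_nonneg (E ^ 2 - 4)]
  rwa [lt_div_iff₀ (decayRate_pos hE), one_mul] at h1

theorem EllTwo.inner_self_eq (x : EllTwo) : inner ℂ x x = ((‖x‖ ^ 2 : ℝ) : ℂ) := by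
  rw [inner_self_eq_norm_sq_to_K]
  simp

theorem inner_sum_smul_of_orthonormal {u : ℝ → EllTwo} {S : Finset ℝ} (d : ℝ → ℂ) (c : ℝ → ℂ)
    (hu : ∀ i ∈ S, ∀ k ∈ S, inner ℂ (u i) (u k) = if i = k then (1 : ℂ) else 0) :
    inner ℂ (∑ i ∈ S, c i • u i) (∑ i ∈ S, d i • u i) =
      ∑ i ∈ S, (starRingEnd ℂ) (c i) * d i := by
  rw [sum_inner]
  refine Finset.sum_congr rfl fun i hi => ?_
  rw [inner_smul_left, inner_sum, Finset.sum_eq_single_of_mem i hi]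
  · rw [inner_smul_right, hu i hi i hi, if_pos rfl, mul_one]
  · intro k hk hki
    rw [inner_smul_right, hu i hi k hk, if_neg hki.symm, mul_zero]

theorem exists_orthonormal_eigenvectors {W : EllTwo →ₗ[ℂ] EllTwo} (hW : W.IsSymmetric)
    {J : Finset ℝ} (hJ : ∀ l ∈ J, Module.End.HasEigenvalue W (l : ℂ)) :
    ∃ u : ℝ → EllTwo, (∀ l ∈ J, W (u l) = (l : ℂ) • u l) ∧
      ∀ i ∈ J, ∀ k ∈ J, inner ℂ (u i) (u k) = if i = k then (1 : ℂ) else 0 := by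
  have h : ∀ l : ℝ, ∃ u : EllTwo, l ∈ J → W u = (l : ℂ) • u ∧ ‖u‖ = 1 := by
    intro l
    by_cases hl : l ∈ J
    · obtain ⟨u, hu⟩ := (hJ l hl).exists_hasEigenvector
      have hne : ‖u‖ ≠ 0 := norm_ne_zero_iff.2 hu.2
      refine ⟨((‖u‖⁻¹ : ℝ) : ℂ) • u, fun _ => ⟨?_, ?_⟩⟩
      · rw [map_smul, hu.apply_eq_smul, smul_comm]
      · rw [norm_smul, Complex.norm_real, norm_inv, norm_norm, inv_mul_cancel₀ hne]
    · exact ⟨0, fun h => absurd h hl⟩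
  choose u hu using h
  refine ⟨u, fun l hl => (hu l hl).1, fun i hi k hk => ?_⟩
  split_ifs with hik
  · subst hik
    rw [inner_self_eq_norm_sq_to_K, (hu i hi).2]
    simp
  · have h1 := hW (u i) (u k)
    rw [(hu i hi).1, (hu k hk).1, inner_smul_left, inner_smul_right, Complex.conj_ofReal] at h1
    have h2 : ((i : ℂ) - k) * inner ℂ (u i) (u k) = 0 := by rw [sub_mul, h1, sub_self]
    refine (mul_eq_zero.1 h2).resolve_left fun h => hik ?_
    exact_mod_cast sub_eq_zero.1 h

/-- The Hundertmark–Simon bound for eigenvalues below `-2 - t`, with a finitely supported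
majorant `v` of the part of the perturbation exceeding `t`. -/
theorem sum_sqrt_eigenvalues_le (a b : ℤ → ℝ) (ha : ∃ C : ℝ, ∀ n, |a n| ≤ C)
    (hb : ∃ C : ℝ, ∀ n, |b n| ≤ C) (t : ℝ) (T : Finset ℤ) (v : ℤ → ℝ) (hv0 : ∀ n, 0 ≤ v n)
    (hvT : ∀ n, n ∉ T → v n = 0)
    (hV : ∀ n, -b n + |a n + 1| + |a (n - 1) + 1| ≤ v n + t) (J : Finset ℝ)
    (hJ2 : ∀ l ∈ J, l < -2 - t)
    (hJ : ∀ l ∈ J, Module.End.HasEigenvalue (jacobiOperator a b ha hb) (l : ℂ)) :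
    ∑ l ∈ J, √((-l - t) ^ 2 - 4) ≤ ∑ n ∈ T, v n := by
  set W := jacobiOperator a b ha hb with hWdef
  obtain ⟨u, huW, hu⟩ := exists_orthonormal_eigenvectors (jacobiOperator_isSymmetric a b ha hb) hJ
  have hsq : ∀ n, √(v n) * √(v n) = v n := fun n => Real.mul_self_sqrt (hv0 n)
  have hvb : ∃ C : ℝ, ∀ n, |v n| ≤ C := by
    refine ⟨∑ n ∈ T, v n, fun n => ?_⟩
    rw [abs_of_nonneg (hv0 n)]
    by_cases hn : n ∈ T
    · exact Finset.single_le_sum (fun n _ => hv0 n) hn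
    · rw [hvT n hn]
      exact Finset.sum_nonneg fun n _ => hv0 n
  -- The flag consists of the eigenvectors weighted by √v and restricted to `T`. As l increases, the
  -- energy -l - t decreases towards 2 and its decay rate increases, which is the order the flag
  -- bound requires.
  have main := sum_le_sum_sq_of_expForm_flag (ι := T) (fun n => (n : ℤ)) (fun n => √(v n))
    (fun l => decayRate (-l - t)) (fun l => √((-l - t) ^ 2 - 4))
    (fun l => WithLp.toLp 2 fun n : T => (√(v n) : ℂ) * u l n) J
    (fun i _ k hk hik => decayRate_anti (by linarith [hJ2 k hk]) (by linarith))
    (fun i hi => decayRate_pos (by linarith [hJ2 i hi]))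
    (fun i hi => (decayRate_lt_one (by linarith [hJ2 i hi])).le) ?_
  · refine main.trans (le_of_eq ?_)
    rw [← Finset.sum_coe_sort T]
    exact Finset.sum_congr rfl fun n _ => Real.sq_sqrt (hv0 n)
  intro j hj S hS hSj c
  set z : EllTwo := ∑ i ∈ S, c i • u i with hz
  have hxz : ∑ i ∈ S, c i • (WithLp.toLp 2 fun n : T => (√(v n) : ℂ) * u i n : EuclideanSpace ℂ T) =
      WithLp.toLp 2 fun n : T => (√(v n) : ℂ) * z n := by
    ext n
    simp only [hz, WithLp.ofLp_sum, WithLp.ofLp_smul, Finset.sum_apply, Pi.smul_apply,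
      lp.coeFn_sum, lp.coeFn_smul, smul_eq_mul, Finset.mul_sum]
    exact Finset.sum_congr rfl fun i _ => by ring
  rw [hxz]
  have huS : ∀ i ∈ S, ∀ k ∈ S, inner ℂ (u i) (u k) = if i = k then (1 : ℂ) else 0 :=
    fun i hi k hk => hu i (hS hi) k (hS hk)
  have hzz : ‖z‖ ^ 2 = ∑ i ∈ S, ‖c i‖ ^ 2 := by
    have h1 := inner_sum_smul_of_orthonormal c c huS
    rw [← hz, EllTwo.inner_self_eq] at h1
    simp only [Complex.conj_mul'] at h1
    exact_mod_cast h1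
  -- All eigenvalues occurring in `z` are at most j, so the form of `W` on their span is too.
  have hWz : (inner ℂ z (W z)).re ≤ j * ‖z‖ ^ 2 := by
    have e : W z = ∑ i ∈ S, (c i * (i : ℂ)) • u i := by
      rw [hz, map_sum]
      refine Finset.sum_congr rfl fun i hi => ?_
      rw [map_smul, huW i (hS hi), smul_smul]
    rw [e, hz, inner_sum_smul_of_orthonormal _ c huS, ← hz, hzz, Complex.re_sum, Finset.mul_sum]
    refine Finset.sum_le_sum fun i hi => ?_
    rw [← mul_assoc, Complex.conj_mul', mul_comm, Complex.re_ofReal_mul]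
    norm_cast
    exact mul_le_mul_of_nonneg_right (hSj i hi) (sq_nonneg _)
  have hE : 2 < -j - t := by linarith [hJ2 j hj]
  set μ := decayRate (-j - t) with hμ
  have hμ0 : 0 < μ := decayRate_pos hE
  have hμ1 : μ < 1 := decayRate_lt_one hE
  have hinv : 1 / μ = (-j - t + √((-j - t) ^ 2 - 4)) / 2 := decayRate_inv hE
  have hμdef : μ = (-j - t - √((-j - t) ^ 2 - 4)) / 2 := rfl
  have hadd : μ + 1 / μ = -j - t := by rw [hinv, hμdef]; ring
  have hsub : 1 / μ - μ = √((-j - t) ^ 2 - 4) := by rw [hinv, hμdef]; ring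
  have hA : ∃ C : ℝ, ∀ _ : ℤ, |(-1 : ℝ)| ≤ C := ⟨_, fun _ => le_rfl⟩
  have hB : ∃ C : ℝ, ∀ n, |μ + 1 / μ - v n| ≤ C := by
    obtain ⟨C, hC⟩ := hvb
    exact ⟨|μ + 1 / μ| + C, fun n => (abs_sub _ _).trans (by gcongr; exact hC n)⟩
  have hB2 : ∃ C : ℝ, ∀ n, |b n - j| ≤ C := by
    obtain ⟨C, hC⟩ := hb
    exact ⟨C + |j|, fun n => (abs_sub _ _).trans (by gcongr; exact hC n)⟩
  -- With μ + 1/μ = -j - t, the majorant hypothesis on `v + t` says precisely that W - j dominates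
  -- this free operator with potential.
  have hform : (inner ℂ z (jacobiOperator (fun _ => -1) (fun n => μ + 1 / μ - v n) hA hB z)).re
      ≤ 0 := by
    refine (jacobiOperator_re_inner_mono hA hB ha hB2 (fun n => ?_) z).trans ?_
    · simp only [sub_neg_eq_add, hadd]
      linarith [hV n]
    · have e : jacobiOperator a (fun n => b n - j) ha hB2 z = W z - (j : ℂ) • z := by
        ext n
        simp only [hWdef, lp.coeFn_sub, lp.coeFn_smul, Pi.sub_apply, Pi.smul_apply,
          jacobiOperator_apply, smul_eq_mul]
        push_cast
        ring
      rw [e, inner_sub_right, inner_smul_right, EllTwo.inner_self_eq, Complex.sub_re,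
        Complex.re_ofReal_mul, Complex.ofReal_re]
      linarith
  constructor
  · have h := birman_schwinger_bound hμ0 hμ1 T v hvT hA hB z hform
    rw [hsub] at h
    convert h using 1
    · rw [EuclideanSpace.norm_sq_eq, ← Finset.sum_coe_sort T]
      congr 1
      refine Finset.sum_congr rfl fun n _ => ?_
      simp only [norm_mul, Complex.norm_real, Real.norm_eq_abs, abs_of_nonneg (Real.sqrt_nonneg _)]
      rw [mul_pow, Real.sq_sqrt (hv0 n)]
    · rw [expForm, ← Finset.sum_coe_sort T]
      refine Finset.sum_congr rfl fun n _ => ?_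
      rw [← Finset.sum_coe_sort T]
      refine Finset.sum_congr rfl fun m _ => ?_
      have : (starRingEnd ℂ) ((√(v n) : ℂ) * z n) * ((√(v m) : ℂ) * z m) =
          ((√(v n) * √(v m) : ℝ) : ℂ) * ((starRingEnd ℂ) (z n) * z m) := by
        simp
        ring
      simp only [this, Complex.re_ofReal_mul]
      -- Each √v occurs twice, once as weight of the form and once in the vector; the two pair up to
      -- `v n * v m`.
      linear_combination (√(v n) * √(v n) * (μ ^ ((n : ℤ) - m).natAbs *
        ((starRingEnd ℂ) (z n) * z m).re)) * hsq m + (v m * (μ ^ ((n : ℤ) - m).natAbs *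
        ((starRingEnd ℂ) (z n) * z m).re)) * hsq n
  · intro h0
    have hvz : ∀ n, (v n : ℂ) * z n = 0 := by
      intro n
      by_cases hn : n ∈ T
      · have := congrArg (fun w : EuclideanSpace ℂ T => w ⟨n, hn⟩) h0
        have h2 : (√(v n) : ℂ) * z n = 0 := this
        rw [← hsq n]
        push_cast
        rw [mul_assoc, h2, mul_zero]
      · rw [hvT n hn]
        simp
    -- Where `v` annihilates `z`, the form is that of the free operator plus μ + 1/μ, which is at
    -- least (μ + 1/μ - 2)‖z‖² with a positive factor. Hence `z` = 0, and orthonormality kills the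
    -- coefficients.
    have hC0 : ∃ C : ℝ, ∀ _ : ℤ, |(0 : ℝ)| ≤ C := ⟨_, fun _ => le_rfl⟩
    have hC1 : ∃ C : ℝ, ∀ _ : ℤ, |μ + 1 / μ - 2| ≤ C := ⟨_, fun _ => le_rfl⟩
    have hC2 : ∃ C : ℝ, ∀ _ : ℤ, |μ + 1 / μ| ≤ C := ⟨_, fun _ => le_rfl⟩
    have hm := jacobiOperator_re_inner_mono hC0 hC1 hA hC2 (fun n => by norm_num; linarith) z
    have e1 : jacobiOperator (fun _ => 0) (fun _ => μ + 1 / μ - 2) hC0 hC1 z =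
        ((μ + 1 / μ - 2 : ℝ) : ℂ) • z := by
      ext n
      simp [jacobiOperator_apply]
    have e2 : jacobiOperator (fun _ => -1) (fun _ => μ + 1 / μ) hA hC2 z =
        jacobiOperator (fun _ => -1) (fun n => μ + 1 / μ - v n) hA hB z := by
      ext n
      rw [jacobiOperator_apply, jacobiOperator_apply, Complex.ofReal_sub, sub_mul _ _ (z n), hvz]
      simp
    rw [e1, e2, inner_smul_right, EllTwo.inner_self_eq, Complex.re_ofReal_mul,
      Complex.ofReal_re] at hm
    have h3 : (μ + 1 / μ - 2) * ‖z‖ ^ 2 ≤ 0 := hm.trans hform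
    have h4 : ‖z‖ ^ 2 ≤ 0 := nonpos_of_mul_nonpos_right h3 (by linarith)
    rw [hzz] at h4
    have h5 := (Finset.sum_eq_zero_iff_of_nonneg fun i _ => sq_nonneg ‖c i‖).1
      (le_antisymm h4 (Finset.sum_nonneg fun i _ => sq_nonneg _))
    intro i hi
    simpa using h5 i hi

/-! ### Integration over the threshold -/

theorem measurable_ofReal_rpow (s : ℝ) : Measurable fun t : ℝ => ENNReal.ofReal (t ^ s) :=
  (measurable_id.pow_const s).ennreal_ofReal

/-- The substitution E = x - t turns the distance to the eigenvalue into the threshold. The cutoff t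
< x - 2 selects the eigenvalues -x < -2 - t to which the half-power bound applies. -/
theorem ofReal_jacobiG_eq_lintegral {γ x : ℝ} (hγ : 1 / 2 < γ) (hx : 2 < x) :
    ENNReal.ofReal (jacobiG γ x) = ∫⁻ t in Set.Ioi (0 : ℝ),
      (if t < x - 2 then ENNReal.ofReal √((x - t) ^ 2 - 4) else 0) *
        ENNReal.ofReal (t ^ (γ - 3 / 2)) := by
  have hint : IntervalIntegrable (fun t : ℝ => ((x - t) ^ 2 - 4) ^ (1 / 2 : ℝ) * t ^ (γ - 3 / 2))
      MeasureTheory.volume 0 (x - 2) := by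
    have := ((jacobiG_integrable hγ x).comp_sub_left x).symm
    simpa using this
  have h1 : jacobiG γ x = ∫ t in (0 : ℝ)..(x - 2),
      ((x - t) ^ 2 - 4) ^ (1 / 2 : ℝ) * t ^ (γ - 3 / 2) := by
    have := intervalIntegral.integral_comp_sub_left (a := 0) (b := x - 2)
      (fun E : ℝ => (E ^ 2 - 4) ^ (1 / 2 : ℝ) * (x - E) ^ (γ - 3 / 2)) x
    simp only [sub_sub_cancel, sub_zero] at this
    rw [this, jacobiG]
  rw [intervalIntegrable_iff_integrableOn_Ioc_of_le (by linarith)] at hint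
  rw [h1, intervalIntegral.integral_of_le (by linarith),
    MeasureTheory.ofReal_integral_eq_lintegral_ofReal hint,
    ← MeasureTheory.lintegral_indicator measurableSet_Ioc,
    ← MeasureTheory.lintegral_indicator measurableSet_Ioi]
  · congr 1
    funext t
    by_cases ht : 0 < t
    · rw [Set.indicator_of_mem (s := Set.Ioi (0 : ℝ)) ht]
      rcases lt_trichotomy t (x - 2) with h | h | h
      · rw [Set.indicator_of_mem (s := Set.Ioc 0 (x - 2)) ⟨ht, h.le⟩, if_pos h,
          ← ENNReal.ofReal_mul (Real.sqrt_nonneg _), Real.sqrt_eq_rpow]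
      -- The strict cutoff omits the endpoint t = x - 2, where the square root vanishes anyway.
      · rw [Set.indicator_of_mem (s := Set.Ioc 0 (x - 2)) ⟨ht, h.le⟩, if_neg h.not_lt,
          h, sub_sub_cancel]
        norm_num
      · rw [Set.indicator_of_notMem (s := Set.Ioc 0 (x - 2)) (fun hh => h.not_ge hh.2),
          if_neg h.not_gt, zero_mul]
    · rw [Set.indicator_of_notMem (s := Set.Ioc 0 (x - 2)) (fun hh => ht hh.1),
        Set.indicator_of_notMem (s := Set.Ioi (0 : ℝ)) ht]
  · rw [Filter.EventuallyLE, MeasureTheory.ae_restrict_iff' measurableSet_Ioc]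
    refine Filter.Eventually.of_forall fun t ht => ?_
    have h2 : 2 ≤ x - t := by linarith [ht.2]
    exact mul_nonneg (Real.rpow_nonneg (by nlinarith) _) (Real.rpow_nonneg ht.1.le _)

theorem beta_two {s : ℝ} (hs : 0 < s) : ProbabilityTheory.beta s 2 = 1 / (s * (s + 1)) := by
  have h0 := (Real.Gamma_pos_of_pos hs).ne'
  rw [ProbabilityTheory.beta, show s + 2 = s + 1 + 1 by ring,
    Real.Gamma_add_one (by linarith : s + 1 ≠ 0), Real.Gamma_add_one hs.ne', Real.Gamma_two]
  field_simp

theorem lintegral_sub_mul_rpow {γ V : ℝ} (hγ : 1 / 2 < γ) (hV : 0 ≤ V) :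
    ∫⁻ t in Set.Ioi (0 : ℝ), ENNReal.ofReal (V - t) * ENNReal.ofReal (t ^ (γ - 3 / 2)) =
      ENNReal.ofReal (ProbabilityTheory.beta (γ - 1 / 2) 2 * V ^ (γ + 1 / 2)) := by
  have i1 : IntervalIntegrable (fun t : ℝ => t ^ (γ - 3 / 2)) MeasureTheory.volume 0 V :=
    intervalIntegral.intervalIntegrable_rpow' (by linarith)
  have i2 : IntervalIntegrable (fun t : ℝ => t ^ (γ - 1 / 2)) MeasureTheory.volume 0 V :=
    intervalIntegral.intervalIntegrable_rpow' (by linarith)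
  have hint : IntervalIntegrable (fun t : ℝ => (V - t) * t ^ (γ - 3 / 2))
      MeasureTheory.volume 0 V := i1.continuousOn_mul (by fun_prop)
  have hval : ∫ t in (0 : ℝ)..V, (V - t) * t ^ (γ - 3 / 2) =
      ProbabilityTheory.beta (γ - 1 / 2) 2 * V ^ (γ + 1 / 2) := by
    have e : ∫ t in (0 : ℝ)..V, (V - t) * t ^ (γ - 3 / 2) =
        ∫ t in (0 : ℝ)..V, (V * t ^ (γ - 3 / 2) - t ^ (γ - 1 / 2)) := by
      refine intervalIntegral.integral_congr_ae (Filter.Eventually.of_forall fun t ht => ?_)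
      rw [Set.uIoc_of_le hV] at ht
      rw [show γ - 1 / 2 = (γ - 3 / 2) + 1 by ring, Real.rpow_add_one ht.1.ne']
      ring
    rw [e, intervalIntegral.integral_sub (i1.const_mul V) i2, intervalIntegral.integral_const_mul,
      integral_rpow (Or.inl (by linarith)), integral_rpow (Or.inl (by linarith)),
      beta_two (by linarith), show γ - 3 / 2 + 1 = γ - 1 / 2 by ring,
      show γ - 1 / 2 + 1 = γ + 1 / 2 by ring, Real.zero_rpow (by linarith),
      Real.zero_rpow (by linarith)]
    have hVp : V * V ^ (γ - 1 / 2) = V ^ (γ + 1 / 2) := by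
      rw [show γ + 1 / 2 = (γ - 1 / 2) + 1 by ring, Real.rpow_add_one' hV (by linarith), mul_comm]
    have h1 : γ - 1 / 2 ≠ 0 := by linarith
    have h2 : γ - 1 / 2 + 1 ≠ 0 := by linarith
    rw [sub_zero, sub_zero, mul_div_assoc', hVp]
    generalize V ^ (γ + 1 / 2) = Q
    rw [show γ + 1 / 2 = γ - 1 / 2 + 1 by ring]
    generalize γ - 1 / 2 = s at h1 h2 ⊢
    field_simp
    ring
  rw [intervalIntegrable_iff_integrableOn_Ioc_of_le hV] at hint
  rw [← hval, intervalIntegral.integral_of_le hV,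
    MeasureTheory.ofReal_integral_eq_lintegral_ofReal hint,
    ← MeasureTheory.lintegral_indicator measurableSet_Ioc,
    ← MeasureTheory.lintegral_indicator measurableSet_Ioi]
  · congr 1
    funext t
    by_cases ht : 0 < t
    · rw [Set.indicator_of_mem (s := Set.Ioi (0 : ℝ)) ht]
      rcases le_or_gt t V with h | h
      · rw [Set.indicator_of_mem (s := Set.Ioc 0 V) ⟨ht, h⟩, ENNReal.ofReal_mul (by linarith)]
      · rw [Set.indicator_of_notMem (s := Set.Ioc 0 V) (fun hh => h.not_ge hh.2),
          ENNReal.ofReal_of_nonpos (by linarith), zero_mul]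
    · rw [Set.indicator_of_notMem (s := Set.Ioc 0 V) (fun hh => ht hh.1),
        Set.indicator_of_notMem (s := Set.Ioi (0 : ℝ)) ht]
  · rw [Filter.EventuallyLE, MeasureTheory.ae_restrict_iff' measurableSet_Ioc]
    refine Filter.Eventually.of_forall fun t ht => ?_
    exact mul_nonneg (by linarith [ht.2]) (Real.rpow_nonneg ht.1.le _)

/-- The Lieb–Thirring bound for the eigenvalues below `-2`. -/
theorem sum_jacobiG_negative_le {γ : ℝ} (hγ : 1 / 2 < γ) (a b : ℤ → ℝ)
    (ha : ∃ C : ℝ, ∀ n, |a n| ≤ C) (hb : ∃ C : ℝ, ∀ n, |b n| ≤ C) (V : ℤ → ℝ)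
    (hV0 : ∀ n, 0 ≤ V n) (hV : ∀ n, -b n + |a n + 1| + |a (n - 1) + 1| ≤ V n) (J : Finset ℝ)
    (hJ2 : ∀ l ∈ J, l < -2)
    (hJ : ∀ l ∈ J, Module.End.HasEigenvalue (jacobiOperator a b ha hb) (l : ℂ)) :
    ∑ l ∈ J, ENNReal.ofReal (jacobiG γ (-l)) ≤
      ∑' n, ENNReal.ofReal (ProbabilityTheory.beta (γ - 1 / 2) 2 * V n ^ (γ + 1 / 2)) := by
  by_cases htop : ∑' n, ENNReal.ofReal (ProbabilityTheory.beta (γ - 1 / 2) 2 * V n ^ (γ + 1 / 2)) = ⊤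
  · rw [htop]
    exact le_top
  have hβ : 0 < ProbabilityTheory.beta (γ - 1 / 2) 2 := by
    rw [beta_two (by linarith)]
    have : 0 < γ - 1 / 2 := by linarith
    positivity
  -- Convergence of the right-hand sum leaves finitely many sites with V > t, so (V - t)₊ has the
  -- finite support that the half-power bound needs.
  have hfin : ∀ t : ℝ, 0 < t → {n | t < V n}.Finite := by
    intro t ht
    have hpos : 0 < ProbabilityTheory.beta (γ - 1 / 2) 2 * t ^ (γ + 1 / 2) := by positivity
    refine (ENNReal.finite_const_le_of_tsum_ne_top htop
      (ENNReal.ofReal_pos.2 hpos).ne').subset fun n hn => ?_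
    refine ENNReal.ofReal_le_ofReal (mul_le_mul_of_nonneg_left ?_ hβ.le)
    exact Real.rpow_le_rpow ht.le (le_of_lt hn) (by linarith)
  have hk := measurable_ofReal_rpow (γ - 3 / 2)
  calc ∑ l ∈ J, ENNReal.ofReal (jacobiG γ (-l))
      = ∑ l ∈ J, ∫⁻ t in Set.Ioi (0 : ℝ),
          (if t < -l - 2 then ENNReal.ofReal √((-l - t) ^ 2 - 4) else 0) *
            ENNReal.ofReal (t ^ (γ - 3 / 2)) :=
        Finset.sum_congr rfl fun l hl => ofReal_jacobiG_eq_lintegral hγ (by linarith [hJ2 l hl])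
    _ = ∫⁻ t in Set.Ioi (0 : ℝ), ∑ l ∈ J,
          (if t < -l - 2 then ENNReal.ofReal √((-l - t) ^ 2 - 4) else 0) *
            ENNReal.ofReal (t ^ (γ - 3 / 2)) := by
        rw [MeasureTheory.lintegral_finsetSum]
        intro l _
        refine Measurable.mul (Measurable.ite measurableSet_Iio ?_ measurable_const) hk
        exact Measurable.ennreal_ofReal (by fun_prop)
    _ ≤ ∫⁻ t in Set.Ioi (0 : ℝ), ∑' n, ENNReal.ofReal (V n - t) *
          ENNReal.ofReal (t ^ (γ - 3 / 2)) := by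
        refine MeasureTheory.setLIntegral_mono' measurableSet_Ioi fun t ht => ?_
        rw [← Finset.sum_mul, ENNReal.tsum_mul_right]
        refine mul_le_mul_left ?_ _
        rw [← Finset.sum_filter, ← ENNReal.ofReal_sum_of_nonneg fun l _ => Real.sqrt_nonneg _]
        have h := sum_sqrt_eigenvalues_le a b ha hb t (hfin t ht).toFinset
          (fun n => max (V n - t) 0) (fun n => le_max_right _ _)
          (fun n hn => by
            have hn' : V n ≤ t := not_lt.1 fun h => hn ((Set.Finite.mem_toFinset _).2 h)
            exact max_eq_right (by linarith))
          (fun n => by linarith [hV n, le_max_left (V n - t) 0])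
          (J.filter fun l => t < -l - 2)
          (fun l hl => by linarith [(Finset.mem_filter.1 hl).2])
          (fun l hl => hJ l (Finset.mem_filter.1 hl).1)
        refine (ENNReal.ofReal_le_ofReal h).trans ?_
        rw [ENNReal.ofReal_sum_of_nonneg fun n _ => le_max_right _ _]
        simp only [ENNReal.ofReal_max, ENNReal.ofReal_zero, max_zero]
        exact ENNReal.sum_le_tsum _
    _ = ∑' n, ∫⁻ t in Set.Ioi (0 : ℝ), ENNReal.ofReal (V n - t) *
          ENNReal.ofReal (t ^ (γ - 3 / 2)) := by
        refine MeasureTheory.lintegral_tsum fun n => (Measurable.mul ?_ hk).aemeasurable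
        exact Measurable.ennreal_ofReal (by fun_prop)
    _ = _ := tsum_congr fun n => lintegral_sub_mul_rpow hγ (hV0 n)

/-! ### Positive eigenvalues and the constants -/

/-- Conjugation by the unitary (-1)^n reverses the sign of the off-diagonal entries; negating the
operator restores them and reverses the diagonal and the spectrum. -/
theorem hasEigenvalue_jacobiOperator_neg {a b : ℤ → ℝ} (ha : ∃ C : ℝ, ∀ n, |a n| ≤ C)
    (hb : ∃ C : ℝ, ∀ n, |b n| ≤ C) (hb' : ∃ C : ℝ, ∀ n, |-b n| ≤ C) {l : ℝ}
    (h : Module.End.HasEigenvalue (jacobiOperator a b ha hb) (l : ℂ)) :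
    Module.End.HasEigenvalue (jacobiOperator a (fun n => -b n) ha hb') ((-l : ℝ) : ℂ) := by
  obtain ⟨u, hu⟩ := h.exists_hasEigenvector
  have hs : ∃ C : ℝ, ∀ n : ℤ, |(-1 : ℝ) ^ n| ≤ C := ⟨1, fun n => by simp [abs_zpow]⟩
  let w : EllTwo := ⟨fun n => (((-1 : ℝ) ^ n : ℝ) : ℂ) * u n, memlp_two_mul hs (lp.memℓp u)⟩
  have hw : ∀ n, w n = (((-1 : ℝ) ^ n : ℝ) : ℂ) * u n := fun _ => rfl
  refine Module.End.hasEigenvalue_of_hasEigenvector (x := w)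
    ⟨Module.End.mem_eigenspace_iff.2 ?_, fun h0 => hu.2 ?_⟩
  · ext n
    have h1 := congrArg (fun x : EllTwo => x n) hu.apply_eq_smul
    simp only [jacobiOperator_apply, lp.coeFn_smul, Pi.smul_apply, smul_eq_mul] at h1
    simp only [jacobiOperator_apply, lp.coeFn_smul, Pi.smul_apply, smul_eq_mul, hw]
    rw [zpow_sub_one₀ (by norm_num), zpow_add_one₀ (by norm_num)]
    push_cast
    rw [inv_neg_one]
    linear_combination -((-1 : ℂ) ^ n) * h1
  · ext n
    have h1 := congrArg (fun x : EllTwo => x n) h0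
    simp only [hw] at h1
    exact (mul_eq_zero.1 h1).resolve_left
      (Complex.ofReal_ne_zero.2 (zpow_ne_zero n (by norm_num)))

theorem add_add_rpow_le {x y z p : ℝ} (hx : 0 ≤ x) (hy : 0 ≤ y) (hz : 0 ≤ z) (hp : 1 ≤ p) :
    (x + y + z) ^ p ≤ 3 ^ (p - 1) * (x ^ p + y ^ p + z ^ p) := by
  have := Real.rpow_sum_le_const_mul_sum_rpow (Finset.univ : Finset (Fin 3)) ![x, y, z] hp
  simpa [Fin.sum_univ_three, abs_of_nonneg hx, abs_of_nonneg hy, abs_of_nonneg hz] using this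

theorem max_rpow_add_max_neg_rpow (x : ℝ) {p : ℝ} (hp : 0 < p) :
    max (-x) 0 ^ p + max x 0 ^ p = |x| ^ p := by
  rcases le_total 0 x with h | h
  · rw [max_eq_right (by linarith), max_eq_left h, abs_of_nonneg h, Real.zero_rpow hp.ne', zero_add]
  · rw [max_eq_left (by linarith), max_eq_right h, abs_of_nonpos h, Real.zero_rpow hp.ne', add_zero]

theorem mainTheorem4 (γ : ℝ) (hγ : 1 / 2 < γ) (a b : ℤ → ℝ)
    (ha : ∃ C : ℝ, ∀ n, |a n| ≤ C) (hb : ∃ C : ℝ, ∀ n, |b n| ≤ C)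
    (ha_neg : ∀ n, a n < 0) (ha_lim : Tendsto a cofinite (𝓝 (-1))) :
    (∑' l : outerEigenvalues (jacobiOperator a b ha hb), ENNReal.ofReal (jacobiG γ |(l : ℝ)|)) ≤
      ENNReal.ofReal ((3 : ℝ) ^ (γ - 1 / 2) * ProbabilityTheory.beta (γ - 1 / 2) 2) *
        ((∑' n : ℤ, ENNReal.ofReal (|b n| ^ (γ + 1 / 2))) +
          4 * ∑' n : ℤ, ENNReal.ofReal (|a n + 1| ^ (γ + 1 / 2))) := by
  have hb' : ∃ C : ℝ, ∀ n, |-b n| ≤ C := by simpa using hb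
  set p := γ + 1 / 2 with hp
  set B := ProbabilityTheory.beta (γ - 1 / 2) 2 with hB
  have hB0 : 0 ≤ B := by
    rw [hB, beta_two (by linarith)]
    have : 0 < γ - 1 / 2 := by linarith
    positivity
  -- Only the negative part of b lowers the form, and only its positive part raises it. Splitting b
  -- this way lets the two signs of eigenvalues share a single |b|^p in total.
  let V₁ : ℤ → ℝ := fun n => max (-b n) 0 + |a n + 1| + |a (n - 1) + 1|
  let V₂ : ℤ → ℝ := fun n => max (b n) 0 + |a n + 1| + |a (n - 1) + 1|
  have hV₁ : ∀ n, 0 ≤ V₁ n := fun n => by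
    have := le_max_right (-b n) 0
    positivity
  have hV₂ : ∀ n, 0 ≤ V₂ n := fun n => by
    have := le_max_right (b n) 0
    positivity
  have hrhs : (∑' n, ENNReal.ofReal (B * V₁ n ^ p)) + ∑' n, ENNReal.ofReal (B * V₂ n ^ p) ≤
      ENNReal.ofReal ((3 : ℝ) ^ (γ - 1 / 2) * B) *
        ((∑' n : ℤ, ENNReal.ofReal (|b n| ^ p)) + 4 * ∑' n : ℤ, ENNReal.ofReal (|a n + 1| ^ p)) := by
    have hshift : ∑' n : ℤ, ENNReal.ofReal (|a (n - 1) + 1| ^ p) =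
        ∑' n : ℤ, ENNReal.ofReal (|a n + 1| ^ p) :=
      (Equiv.subRight (1 : ℤ)).tsum_eq fun n => ENNReal.ofReal (|a n + 1| ^ p)
    -- The factor 4 counts each |a(n)+1|^p for its two adjacent sites and for both of `V₁` and `V₂`.
    have hsum : (∑' n : ℤ, ENNReal.ofReal (|b n| ^ p)) +
        4 * ∑' n : ℤ, ENNReal.ofReal (|a n + 1| ^ p) =
        ∑' n : ℤ, (ENNReal.ofReal (|b n| ^ p) + (2 * ENNReal.ofReal (|a n + 1| ^ p) +
          2 * ENNReal.ofReal (|a (n - 1) + 1| ^ p))) := by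
      rw [ENNReal.tsum_add, ENNReal.tsum_add, ENNReal.tsum_mul_left, ENNReal.tsum_mul_left, hshift,
        ← add_mul]
      norm_num
    rw [hsum, ← ENNReal.tsum_mul_left, ← ENNReal.tsum_add]
    refine ENNReal.tsum_le_tsum fun n => ?_
    have n1 : 0 ≤ |b n| ^ p := by positivity
    have n2 : 0 ≤ |a n + 1| ^ p := by positivity
    have n3 : 0 ≤ |a (n - 1) + 1| ^ p := by positivity
    rw [← ENNReal.ofReal_add (mul_nonneg hB0 (Real.rpow_nonneg (hV₁ n) _))
      (mul_nonneg hB0 (Real.rpow_nonneg (hV₂ n) _)),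
      show (2 : ℝ≥0∞) = ENNReal.ofReal 2 by norm_num,
      ← ENNReal.ofReal_mul (by norm_num), ← ENNReal.ofReal_mul (by norm_num),
      ← ENNReal.ofReal_add (by positivity) (by positivity),
      ← ENNReal.ofReal_add (by positivity) (by positivity),
      ← ENNReal.ofReal_mul (by positivity)]
    refine ENNReal.ofReal_le_ofReal ?_
    have k1 := add_add_rpow_le (le_max_right (-b n) 0) (abs_nonneg (a n + 1))
      (abs_nonneg (a (n - 1) + 1)) (by linarith : 1 ≤ p)
    have k2 := add_add_rpow_le (le_max_right (b n) 0) (abs_nonneg (a n + 1))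
      (abs_nonneg (a (n - 1) + 1)) (by linarith : 1 ≤ p)
    have k3 := max_rpow_add_max_neg_rpow (b n) (by linarith : 0 < p)
    rw [← mul_add, ← k3, mul_comm _ B, mul_assoc]
    refine mul_le_mul_of_nonneg_left ((add_le_add k1 k2).trans (le_of_eq ?_)) hB0
    rw [show p - 1 = γ - 1 / 2 by rw [hp]; ring]
    ring
  refine le_trans ?_ hrhs
  rw [ENNReal.tsum_eq_iSup_sum]
  refine iSup_le fun s => ?_
  have hmap : ∑ l ∈ s, ENNReal.ofReal (jacobiG γ |(l : ℝ)|) =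
      ∑ l ∈ s.map (Function.Embedding.subtype _), ENNReal.ofReal (jacobiG γ |l|) := by
    rw [Finset.sum_map]
    rfl
  set J := s.map (Function.Embedding.subtype _) with hJdef
  have hJ : ∀ l ∈ J, l ∈ outerEigenvalues (jacobiOperator a b ha hb) := by
    intro l hl
    obtain ⟨x, _, rfl⟩ := Finset.mem_map.1 hl
    exact x.2
  rw [hmap, ← Finset.sum_filter_add_sum_filter_not J (fun l => l < 0)]
  refine add_le_add ?_ ?_
  · have h := sum_jacobiG_negative_le hγ a b ha hb V₁ hV₁
      (fun n => by linarith [le_max_left (-b n) 0]) (J.filter fun l => l < 0)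
      (fun l hl => by
        obtain ⟨h1, h2⟩ := Finset.mem_filter.1 hl
        have := (hJ l h1).1
        rw [abs_of_neg h2] at this
        linarith)
      (fun l hl => (hJ l (Finset.mem_filter.1 hl).1).2)
    refine le_trans (le_of_eq (Finset.sum_congr rfl fun l hl => ?_)) h
    rw [abs_of_neg (Finset.mem_filter.1 hl).2]
  · have h := sum_jacobiG_negative_le hγ a (fun n => -b n) ha hb' V₂ hV₂
      (fun n => by linarith [le_max_left (b n) 0])
      ((J.filter fun l => ¬ l < 0).map (Equiv.neg ℝ).toEmbedding)
      (fun l hl => by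
        obtain ⟨x, hx, rfl⟩ := Finset.mem_map.1 hl
        obtain ⟨h1, h2⟩ := Finset.mem_filter.1 hx
        have := (hJ x h1).1
        rw [abs_of_nonneg (not_lt.1 h2)] at this
        change -x < -2
        linarith)
      (fun l hl => by
        obtain ⟨x, hx, rfl⟩ := Finset.mem_map.1 hl
        exact hasEigenvalue_jacobiOperator_neg ha hb hb' (hJ x (Finset.mem_filter.1 hx).1).2)
    rw [Finset.sum_map] at h
    refine le_trans (le_of_eq (Finset.sum_congr rfl fun l hl => ?_)) h
    rw [abs_of_nonneg (not_lt.1 (Finset.mem_filter.1 hl).2)]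
    simp
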